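/- Let $n\ge 1$ and let $H_{2n+1}$ be the Heisenberg group, i.e. $\mathbb R^{2n}\times\mathbb R$ with multiplication $(x,\lambda)(y,\mu)=(x+y,\lambda+\mu+\omega(x,y))$, where $\omega$ is the standard symplectic form on $\mathbb R^{2n}$. Let $g$ be a smooth Riemannian metric and $X$ a smooth vector field on $H_{2n+1}$ with $\sqrt{g(X,X)}<1$ everywhere, and let $F(x,y)=\sqrt{g(y,y)}+g(X(x),y)$ be the associated Randers metric. Suppose that $F$ is left-invariant, i.e. $F(a,v)=F(e,(dL_{a^{-1}})_a v)$ for all $a\in H_{2n+1}$ and $v\in T_aH_{2n+1}$ (where $L_a b = ab$), that $F$ is not Riemannian, i.e. $X\not\equiv 0$, and that $F$ is of Douglas type, i.e. the $1$-form $g(X,\cdot)$ is closed. Then $F$ is not Ricci-quadratic. Here $F$ is called Ricci-quadratic if for every point $x$ there is a quadratic form $q$ on the tangent space at $x$ with $\mathrm{Ric}(x,y)=q(y)$ for all tangent vectors $y\ne 0$ at $x$; $\mathrm{Ric}(x,y)=\sum_i R^i{}_i(x,y)$ is the trace of the Riemann curvature $$R^i{}_k=2\frac{\partial G^i}{\partial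 x^k}-y^j\frac{\partial^2G^i}{\partial x^j\partial y^k}+2G^j\frac{\partial^2G^i}{\partial y^j\partial y^k}-\frac{\partial G^i}{\partial y^j}\frac{\partial G^j}{\partial y^k},$$ $$G^i=\tfrac14 g^{il}\Big(\frac{\partial^2F^2}{\partial x^k\partial y^l}y^k-\frac{\partial F^2}{\partial x^l}\Big),\qquad (g^{il})=(g_{il})^{-1},\quad g_{il}=\tfrac12\frac{\partial^2F^2}{\partial y^i\partial y^l}.$$ -/

import Mathlib

open scoped ContDiff

noncomputable section

/-! ### Finsler geometry in a global coordinate system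

A function `F` on the tangent bundle of `ℝ^ι` is written `F x y`, with `x` the point and `y` the
tangent vector at `x`, in standard coordinates. -/

namespace Finsler

variable {ι : Type} [Fintype ι] [DecidableEq ι]

/-- The partial derivative `∂f/∂x^k` of a function `f (x, y)` on the tangent bundle. -/
def pdx (k : ι) (f : (ι → ℝ) → (ι → ℝ) → ℝ) : (ι → ℝ) → (ι → ℝ) → ℝ :=
  fun x y => fderiv ℝ (fun x' => f x' y) x (Pi.single k 1)

/-- The partial derivative `∂f/∂y^k` of a function `f (x, y)` on the tangent bundle. -/
def pdy (k : ι) (f : (ι → ℝ) → (ι → ℝ) → ℝ) : (ι → ℝ) → (ι → ℝ) → ℝ :=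
  fun x y => fderiv ℝ (fun y' => f x y') y (Pi.single k 1)

/-- The fundamental tensor `g_ij (x, y) = (1/2) ∂²F²/∂y^i∂y^j`. -/
def fundamentalTensor (F : (ι → ℝ) → (ι → ℝ) → ℝ) (x y : ι → ℝ) : Matrix ι ι ℝ :=
  Matrix.of fun i j => (1 / 2) * pdy i (pdy j (fun x y => F x y ^ 2)) x y

/-- The geodesic spray coefficients
`G^i = (1/4) g^{il} (∂²F²/∂x^k∂y^l y^k - ∂F²/∂x^l)`. -/
def spray (F : (ι → ℝ) → (ι → ℝ) → ℝ) (i : ι) (x y : ι → ℝ) : ℝ :=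
  (1 / 4) * ∑ l, (fundamentalTensor F x y)⁻¹ i l *
    ((∑ k, pdx k (pdy l (fun x y => F x y ^ 2)) x y * y k) - pdx l (fun x y => F x y ^ 2) x y)

/-- The Riemann curvature of `F`, that is the endomorphism `R_y = R(·, y)y`, with components
`R^i_k = 2 ∂G^i/∂x^k - y^j ∂²G^i/∂x^j∂y^k + 2 G^j ∂²G^i/∂y^j∂y^k - ∂G^i/∂y^j ∂G^j/∂y^k`. -/
def riemannCurvature (F : (ι → ℝ) → (ι → ℝ) → ℝ) (x y : ι → ℝ) : Matrix ι ι ℝ :=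
  Matrix.of fun i k =>
    2 * pdx k (spray F i) x y
      - ∑ j, y j * pdx j (pdy k (spray F i)) x y
      + 2 * ∑ j, spray F j x y * pdy j (pdy k (spray F i)) x y
      - ∑ j, pdy j (spray F i) x y * pdy k (spray F j) x y

/-- The Ricci curvature `Ric (x, y) = R^i_i (x, y)`. -/
def ricci (F : (ι → ℝ) → (ι → ℝ) → ℝ) (x y : ι → ℝ) : ℝ :=
  (riemannCurvature F x y).trace

/-- `F` is Ricci-quadratic: on each tangent space `Ric (x, y)` is a quadratic form in `y`
(the Ricci curvature lives on the slit tangent bundle `y ≠ 0`). -/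
def IsRicciQuadratic (F : (ι → ℝ) → (ι → ℝ) → ℝ) : Prop :=
  ∀ x : ι → ℝ, ∃ q : QuadraticForm ℝ (ι → ℝ), ∀ y : ι → ℝ, y ≠ 0 → ricci F x y = q y

/-- The data defining a Randers metric: a smooth Riemannian metric `g` and a smooth vector
field `X` with `g(X, X) < 1`. -/
structure RandersData (ι : Type) [Fintype ι] where
  g : (ι → ℝ) → Matrix ι ι ℝ
  X : (ι → ℝ) → ι → ℝ
  smooth_g : ∀ i j, ContDiff ℝ ∞ (fun x => g x i j)
  posDef_g : ∀ x, (g x).PosDef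
  smooth_X : ContDiff ℝ ∞ X
  norm_lt_one : ∀ x, Real.sqrt (X x ⬝ᵥ (g x).mulVec (X x)) < 1

/-- The Randers metric `F (x, y) = √(g(y, y)) + g(X(x), y)`. -/
def RandersData.metric (R : RandersData ι) (x y : ι → ℝ) : ℝ :=
  Real.sqrt (y ⬝ᵥ (R.g x).mulVec y) + R.X x ⬝ᵥ (R.g x).mulVec y

/-- The `1`-form `β = g(X, ·)`, as its vector of components `β_j = g_{jk} X^k`. -/
def RandersData.form (R : RandersData ι) (x : ι → ℝ) : ι → ℝ :=
  (R.g x).mulVec (R.X x)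

/-- The Randers metric is of Douglas type: the `1`-form `g(X, ·)` is closed, `∂_i β_j = ∂_j β_i`. -/
def RandersData.IsDouglas (R : RandersData ι) : Prop :=
  ∀ (x : ι → ℝ) (i j : ι),
    fderiv ℝ (fun x' => R.form x' j) x (Pi.single i 1) =
      fderiv ℝ (fun x' => R.form x' i) x (Pi.single j 1)

end Finsler

/-! ### The Heisenberg group `H_{2n+1}` on `ℝ^{2n} × ℝ` -/

namespace Heisenberg

/-- Labels of the `2n + 1` coordinates: `2n` symplectic ones (`n` positions, `n` momenta) and the
central one. -/
abbrev Idx (n : ℕ) : Type := (Fin n ⊕ Fin n) ⊕ Unit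

/-- The standard symplectic form of `ℝ^{2n}`, evaluated on the symplectic parts of two points. -/
def omega {n : ℕ} (a b : Idx n → ℝ) : ℝ :=
  ∑ i : Fin n, (a (Sum.inl (Sum.inl i)) * b (Sum.inl (Sum.inr i))
    - a (Sum.inl (Sum.inr i)) * b (Sum.inl (Sum.inl i)))

/-- The multiplication `(x, s) (y, t) = (x + y, s + t + ω(x, y))`. -/
def mul {n : ℕ} (a b : Idx n → ℝ) : Idx n → ℝ :=
  Sum.elim (fun k => a (Sum.inl k) + b (Sum.inl k))
    (fun u => a (Sum.inr u) + b (Sum.inr u) + omega a b)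

/-- The inverse `(x, s)⁻¹ = (-x, -s)`. -/
def inv {n : ℕ} (a : Idx n → ℝ) : Idx n → ℝ := fun k => -a k

theorem mul_assoc' {n : ℕ} (a b c : Idx n → ℝ) : mul (mul a b) c = mul a (mul b c) := by
  funext k
  rcases k with k | u
  · simp only [mul, Sum.elim_inl]; ring
  · simp only [mul, Sum.elim_inr, Sum.elim_inl, omega, add_mul, mul_add,
      Finset.sum_add_distrib, Finset.sum_sub_distrib]
    ring

theorem zero_mul' {n : ℕ} (a : Idx n → ℝ) : mul 0 a = a := by
  funext k
  rcases k with k | u <;> simp [mul, omega]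

theorem inv_mul' {n : ℕ} (a : Idx n → ℝ) : mul (inv a) a = 0 := by
  funext k
  rcases k with k | u
  · simp [mul, inv]
  · simp only [mul, inv, omega, Sum.elim_inr, neg_add_cancel, zero_add]
    exact Finset.sum_eq_zero fun i _ => by ring

/-- `F` is left-invariant: `F (a, v) = F (e, (L_{a⁻¹})_* v)`, where `L_a b = a b` and the
unit `e` is the origin. -/
def IsLeftInvariant {n : ℕ} (F : (Idx n → ℝ) → (Idx n → ℝ) → ℝ) : Prop :=
  ∀ a v : Idx n → ℝ, F a v = F 0 (fderiv ℝ (mul (inv a)) a v)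

end Heisenberg

end

noncomputable section

namespace Finsler

variable {ι : Type} [Fintype ι]

/-! ### Left-invariant Randers metrics on groups with a one-dimensional derived algebra -/

/-! Left-invariance determines `F` by the inner product `B` and the vector `X` at the unit. The form
`g(X, ·)` is the odd part of `F`, so it is left-invariant too; closedness then forces `X ⟂ Z` for
the central vector `Z` (`formCLM_X_center`), and the form has constant coefficients. This is the
model `TwoStepRanders`.

For closed `β` the spray of `F = α + β` is that of `α` plus `P y`, here with `P = Ω(y, X) B(Z, u) /
F` and `u` the left translate of `y` (`spray_metric`). Taking traces at the unit in dimension `N`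
gives `ricci_metric_zero`: a quadratic form plus `(N - 1) (3 Ω(y, X)² B(Z, y)² / F² - 2 B(Z, y)²
Ω(Jy, X) / F)`.

To see that this is not quadratic, take `v ⟂ X, Z` with `Ω(v, X) ≠ 0` and `y = v + t Z`. There `β(y)
= 0`, so `F(y) = F(-y)`; averaging over `±y` kills the odd `1/F` term and leaves a positive multiple
of `t² / (A + C t²)`, with `A = B(v, v)` and `C = B(Z, Z)`, besides a quadratic polynomial in `t`. A
quadratic form cannot produce it (`not_isRicciQuadratic`). Such a `v` exists because `X`, nonzero
and orthogonal to `Z`, is not central and `ω` is nondegenerate modulo the center. -/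

/-- A Randers metric `√(B u u) + B X y` with `u = y - Ω x y • Z`: the left-invariant Randers metric
of Douglas type on the group with product `x + y + Ω x y • Z`, given by an inner product `B` and a
vector `X` orthogonal to the central vector `Z`. The operator `J` represents `Ω` with respect
to `B`. -/
structure TwoStepRanders (ι : Type) [Fintype ι] where
  B : (ι → ℝ) →L[ℝ] (ι → ℝ) →L[ℝ] ℝ
  Ω : (ι → ℝ) →L[ℝ] (ι → ℝ) →L[ℝ] ℝ
  Z : ι → ℝ
  X : ι → ℝ
  J : (ι → ℝ) →L[ℝ] (ι → ℝ)
  B_symm : ∀ v w, B v w = B w v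
  B_pos : ∀ v, v ≠ 0 → 0 < B v v
  Ω_self : ∀ v, Ω v v = 0
  Ω_Z : ∀ v, Ω v Z = 0
  B_J : ∀ v w, B (J v) w = Ω v w
  B_X_Z : B X Z = 0
  B_X_X : B X X < 1

/-- A linear functional evaluated through its values on the standard basis. -/
theorem sum_apply_single_mul [DecidableEq ι] (l : (ι → ℝ) →L[ℝ] ℝ) (v : ι → ℝ) :
    ∑ i, l (Pi.single i 1) * v i = l v := by
  conv_rhs => rw [pi_eq_sum_univ' v, map_sum]
  refine Finset.sum_congr rfl fun i _ => ?_
  rw [map_smul, smul_eq_mul, mul_comm]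

theorem hasFDerivAt_inv_comp {f : (ι → ℝ) → ℝ} {f' : (ι → ℝ) →L[ℝ] ℝ} {p : ι → ℝ}
    (hf : HasFDerivAt f f' p) (h : f p ≠ 0) :
    HasFDerivAt (fun p => (f p)⁻¹) ((-(f p ^ 2)⁻¹) • f') p :=
  (hasDerivAt_inv h).comp_hasFDerivAt p hf

namespace TwoStepRanders

variable (S : TwoStepRanders ι)

theorem Ω_swap (v w : ι → ℝ) : S.Ω v w = -S.Ω w v := by
  have h := S.Ω_self (v + w)
  simp only [map_add, add_apply, S.Ω_self] at h
  linarith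

theorem Ω_Z_left (v : ι → ℝ) : S.Ω S.Z v = 0 := by
  rw [S.Ω_swap, S.Ω_Z, neg_zero]

theorem B_J_right (v w : ι → ℝ) : S.B v (S.J w) = S.Ω w v := by
  rw [S.B_symm, S.B_J]

theorem B_Z_X : S.B S.Z S.X = 0 := by rw [S.B_symm, S.B_X_Z]

theorem eq_zero_of_forall_B {v : ι → ℝ} (h : ∀ w, S.B v w = 0) : v = 0 := by
  by_contra hv
  exact (S.B_pos v hv).ne' (h v)

theorem J_Z : S.J S.Z = 0 :=
  S.eq_zero_of_forall_B fun w => by rw [S.B_J, S.Ω_Z_left]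

/-- The left translation of tangent vectors at `x` to the unit. -/
def frame (x : ι → ℝ) : (ι → ℝ) →L[ℝ] (ι → ℝ) :=
  ContinuousLinearMap.id ℝ _ - (S.Ω x).smulRight S.Z

theorem frame_apply (x y : ι → ℝ) : S.frame x y = y - S.Ω x y • S.Z := by
  simp [frame]

theorem frame_zero (y : ι → ℝ) : S.frame 0 y = y := by
  simp [frame_apply]

theorem frame_Z (x : ι → ℝ) : S.frame x S.Z = S.Z := by
  simp [frame_apply, S.Ω_Z]

theorem Ω_frame (v x y : ι → ℝ) : S.Ω v (S.frame x y) = S.Ω v y := by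
  simp [frame_apply, S.Ω_Z]

/-- Left translation changes a vector only along `Z`, which is orthogonal to `X`; this is why the
linear part of the metric does not depend on `x`. -/
theorem B_X_frame (x y : ι → ℝ) : S.B S.X (S.frame x y) = S.B S.X y := by
  simp [frame_apply, S.B_X_Z]

theorem frame_ne_zero (x : ι → ℝ) {y : ι → ℝ} (hy : y ≠ 0) : S.frame x y ≠ 0 := by
  intro h
  have h1 : y = S.Ω x y • S.Z := by rwa [frame_apply, sub_eq_zero] at h
  have h2 : S.Ω x y = 0 := by rw [h1, map_smul, S.Ω_Z, smul_zero]
  rw [h2, zero_smul] at h1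
  exact hy h1

theorem hasFDerivAt_frame_left (x y : ι → ℝ) :
    HasFDerivAt (fun x => S.frame x y) (-(S.Ω.flip y).smulRight S.Z) x := by
  have h : (fun x => S.frame x y) = fun x => y - (S.Ω.flip y) x • S.Z := by
    funext x; simp [frame_apply]
  rw [h]
  have h1 := ((S.Ω.flip y).hasFDerivAt (x := x)).smul_const S.Z
  exact h1.const_sub y

/-- The norm of the Riemannian part. -/
def alpha (x y : ι → ℝ) : ℝ := √(S.B (S.frame x y) (S.frame x y))

/-- The Randers metric. -/
def metric (x y : ι → ℝ) : ℝ := S.alpha x y + S.B S.X y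

theorem B_frame_self_pos (x : ι → ℝ) {y : ι → ℝ} (hy : y ≠ 0) :
    0 < S.B (S.frame x y) (S.frame x y) :=
  S.B_pos _ (S.frame_ne_zero x hy)

theorem alpha_pos (x : ι → ℝ) {y : ι → ℝ} (hy : y ≠ 0) : 0 < S.alpha x y :=
  Real.sqrt_pos.2 (S.B_frame_self_pos x hy)

theorem B_self_nonneg (v : ι → ℝ) : 0 ≤ S.B v v := by
  by_cases hv : v = 0
  · simp [hv]
  · exact (S.B_pos v hv).le

theorem alpha_sq (x y : ι → ℝ) : S.alpha x y ^ 2 = S.B (S.frame x y) (S.frame x y) :=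
  Real.sq_sqrt (S.B_self_nonneg _)

theorem cauchy_schwarz (v w : ι → ℝ) : S.B v w ^ 2 ≤ S.B v v * S.B w w := by
  by_cases hw : w = 0
  · simp [hw]
  have hp := S.B_pos w hw
  -- Its square norm is `B w w` times the Gram determinant of `v` and `w`.
  have h := S.B_self_nonneg (S.B w w • v - S.B v w • w)
  simp only [map_sub, map_smul, sub_apply, smul_apply, smul_eq_mul, S.B_symm w v] at h
  have h2 : 0 ≤ S.B w w * (S.B v v * S.B w w - S.B v w ^ 2) := by nlinarith [h]
  nlinarith [nonneg_of_mul_nonneg_right h2 hp]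

theorem metric_pos (x : ι → ℝ) {y : ι → ℝ} (hy : y ≠ 0) : 0 < S.metric x y := by
  have hα := S.alpha_pos x hy
  have h1 := S.cauchy_schwarz S.X (S.frame x y)
  rw [S.B_X_frame, ← S.alpha_sq] at h1
  have h2 : S.B S.X y ^ 2 < S.alpha x y ^ 2 := by
    nlinarith [S.B_X_X, pow_pos hα 2]
  have h3 := abs_lt_of_sq_lt_sq h2 hα.le
  unfold metric
  linarith [(abs_lt.1 h3).1]

theorem hasFDerivAt_sqrt_B {c : (ι → ℝ) → ι → ℝ} {c' : (ι → ℝ) →L[ℝ] ι → ℝ} {p : ι → ℝ}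
    (hc : HasFDerivAt c c' p) (h0 : c p ≠ 0) :
    HasFDerivAt (fun p => √(S.B (c p) (c p))) ((√(S.B (c p) (c p)))⁻¹ • (S.B (c p)).comp c') p := by
  have hp := S.B_pos _ h0
  have h1 := (S.B.hasFDerivAt.comp p hc).clm_apply hc
  have h2 := h1.sqrt hp.ne'
  refine h2.congr_fderiv ?_
  ext w
  have h3 : √(S.B (c p) (c p)) ≠ 0 := (Real.sqrt_pos.2 hp).ne'
  simp [S.B_symm (c' _) (c p)]
  field_simp
  ring

theorem hasFDerivAt_alpha_right (x : ι → ℝ) {y : ι → ℝ} (hy : y ≠ 0) :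
    HasFDerivAt (fun y => S.alpha x y)
      ((S.alpha x y)⁻¹ • (S.B (S.frame x y)).comp (S.frame x)) y :=
  S.hasFDerivAt_sqrt_B (S.frame x).hasFDerivAt (S.frame_ne_zero x hy)

theorem hasFDerivAt_alpha_left (x : ι → ℝ) {y : ι → ℝ} (hy : y ≠ 0) :
    HasFDerivAt (fun x => S.alpha x y)
      ((S.alpha x y)⁻¹ • (S.B (S.frame x y)).comp (-(S.Ω.flip y).smulRight S.Z)) x :=
  S.hasFDerivAt_sqrt_B (S.hasFDerivAt_frame_left x y) (S.frame_ne_zero x hy)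

/-- The differential of the metric along the fibre. -/
def metricDeriv (x y : ι → ℝ) : (ι → ℝ) →L[ℝ] ℝ :=
  (S.alpha x y)⁻¹ • (S.B (S.frame x y)).comp (S.frame x) + S.B S.X

theorem metricDeriv_apply (x y w : ι → ℝ) :
    S.metricDeriv x y w = (S.alpha x y)⁻¹ * S.B (S.frame x y) (S.frame x w) + S.B S.X w := by
  simp [metricDeriv]

theorem hasFDerivAt_metric_right (x : ι → ℝ) {y : ι → ℝ} (hy : y ≠ 0) :
    HasFDerivAt (fun y => S.metric x y) (S.metricDeriv x y) y :=
  (S.hasFDerivAt_alpha_right x hy).add (S.B S.X).hasFDerivAt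

theorem hasFDerivAt_metric_left (x : ι → ℝ) {y : ι → ℝ} (hy : y ≠ 0) :
    HasFDerivAt (fun x => S.metric x y)
      ((S.alpha x y)⁻¹ • (S.B (S.frame x y)).comp (-(S.Ω.flip y).smulRight S.Z)) x :=
  (S.hasFDerivAt_alpha_left x hy).add_const _

theorem hasFDerivAt_metricDeriv_right (x : ι → ℝ) {y : ι → ℝ} (hy : y ≠ 0) (w : ι → ℝ) :
    HasFDerivAt (fun y => S.metricDeriv x y w)
      ((S.alpha x y)⁻¹ • (S.B (S.frame x w)).comp (S.frame x)
        - (S.B (S.frame x y) (S.frame x w) * (S.alpha x y)⁻¹ ^ 3) •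
          (S.B (S.frame x y)).comp (S.frame x)) y := by
  have hα := (S.alpha_pos x hy).ne'
  have h1 : HasFDerivAt (fun y => S.B (S.frame x y) (S.frame x w))
      ((S.B (S.frame x w)).comp (S.frame x)) y := by
    have := ((S.B (S.frame x w)).comp (S.frame x)).hasFDerivAt (x := y)
    refine this.congr_of_eventuallyEq (.of_forall fun z => ?_)
    simp [S.B_symm (S.frame x w)]
  have h2 := ((hasFDerivAt_inv_comp (S.hasFDerivAt_alpha_right x hy) hα).fun_mul h1).add_const (S.B S.X w)
  simp only [metricDeriv_apply]
  refine h2.congr_fderiv ?_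
  ext v
  simp
  field_simp
  ring

theorem hasFDerivAt_metricDeriv_left (x : ι → ℝ) {y : ι → ℝ} (hy : y ≠ 0) (w : ι → ℝ) :
    HasFDerivAt (fun x => S.metricDeriv x y w)
      ((S.B (S.frame x y) S.Z * S.B (S.frame x y) (S.frame x w) * (S.alpha x y)⁻¹ ^ 3
          - S.B S.Z (S.frame x w) * (S.alpha x y)⁻¹) • S.Ω.flip y
        - (S.B (S.frame x y) S.Z * (S.alpha x y)⁻¹) • S.Ω.flip w) x := by
  have hα := (S.alpha_pos x hy).ne'
  have h1 := (S.B.hasFDerivAt.comp x (S.hasFDerivAt_frame_left x y)).clm_apply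
    (S.hasFDerivAt_frame_left x w)
  have h2 := ((hasFDerivAt_inv_comp (S.hasFDerivAt_alpha_left x hy) hα).fun_mul h1).add_const (S.B S.X w)
  simp only [metricDeriv_apply]
  refine h2.congr_fderiv ?_
  ext v
  simp
  field_simp
  ring

/-- The fundamental tensor as a bilinear form. -/
def tensor (x y v : ι → ℝ) : (ι → ℝ) →L[ℝ] ℝ :=
  S.metricDeriv x y v • S.metricDeriv x y
    + (S.metric x y * (S.alpha x y)⁻¹) • (S.B (S.frame x v)).comp (S.frame x)
    - (S.metric x y * S.B (S.frame x y) (S.frame x v) * (S.alpha x y)⁻¹ ^ 3) •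
      (S.B (S.frame x y)).comp (S.frame x)

theorem tensor_apply (x y v w : ι → ℝ) : S.tensor x y v w =
    S.metricDeriv x y v * S.metricDeriv x y w
      + S.metric x y * (S.alpha x y)⁻¹ * S.B (S.frame x v) (S.frame x w)
      - S.metric x y * S.B (S.frame x y) (S.frame x v) * (S.alpha x y)⁻¹ ^ 3 *
        S.B (S.frame x y) (S.frame x w) := by
  simp [tensor]

theorem tensor_symm (x y v w : ι → ℝ) : S.tensor x y v w = S.tensor x y w v := by
  rw [tensor_apply, tensor_apply, S.B_symm (S.frame x v) (S.frame x w)]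
  ring

/-- The form is `(dF v)² + F α⁻³ ·` the Gram determinant of `y` and `v` after translation. If the
determinant vanishes, `v` is a nonzero multiple `c y`, and then `dF v = c F ≠ 0`. -/
theorem tensor_self_pos (x : ι → ℝ) {y v : ι → ℝ} (hy : y ≠ 0) (hv : v ≠ 0) :
    0 < S.tensor x y v v := by
  have hα := S.alpha_pos x hy
  have hF := S.metric_pos x hy
  have hcs := S.cauchy_schwarz (S.frame x y) (S.frame x v)
  have hsq := S.alpha_sq x y
  have key : S.tensor x y v v = S.metricDeriv x y v ^ 2 + S.metric x y * (S.alpha x y)⁻¹ ^ 3 *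
      (S.B (S.frame x y) (S.frame x y) * S.B (S.frame x v) (S.frame x v)
        - S.B (S.frame x y) (S.frame x v) ^ 2) := by
    rw [tensor_apply, ← hsq]
    field_simp
    ring
  have hc : 0 < S.metric x y * (S.alpha x y)⁻¹ ^ 3 := by positivity
  rw [key]
  rcases hcs.lt_or_eq with h | h
  · have := mul_pos hc (sub_pos.2 h)
    positivity
  · have hu := S.B_frame_self_pos x hy
    set c := S.B (S.frame x y) (S.frame x v) / S.B (S.frame x y) (S.frame x y) with hcdef
    have h0 : S.frame x (v - c • y) = 0 := by
      by_contra hne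
      have hpos := S.B_pos _ hne
      simp only [map_sub, map_smul, sub_apply, smul_apply, smul_eq_mul,
        S.B_symm (S.frame x v) (S.frame x y)] at hpos
      have hc' : c * S.B (S.frame x y) (S.frame x y) = S.B (S.frame x y) (S.frame x v) := by
        rw [hcdef]; field_simp
      have : 0 < S.B (S.frame x y) (S.frame x y) * (S.B (S.frame x v) (S.frame x v)
          - c * S.B (S.frame x y) (S.frame x v)) := mul_pos hu (by nlinarith)
      nlinarith
    have hvc : v = c • y := by
      by_contra hne
      exact S.frame_ne_zero x (sub_ne_zero.2 hne) h0
    have hc0 : c ≠ 0 := fun h => hv (by rw [hvc, h, zero_smul])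
    have hd : S.metricDeriv x y v = c * S.metric x y := by
      rw [hvc, map_smul, smul_eq_mul, metricDeriv_apply, ← hsq, metric]
      field_simp
    rw [h, sub_self, mul_zero, add_zero, hd]
    positivity

/-- The spray coefficients of the Riemannian part. -/
def riemSpray (x y : ι → ℝ) : ι → ℝ :=
  -(S.B S.Z (S.frame x y)) • (S.J y + S.Ω x (S.J y) • S.Z)

/-- The projective factor between the Randers metric and its Riemannian part. -/
def projFactor (x y : ι → ℝ) : ℝ :=
  S.Ω y S.X * S.B S.Z (S.frame x y) / S.metric x y

/-- The Riemannian spray is the left translate of a multiple of `J y`; the `Z` term in its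
definition is the correction for the coordinates. -/
theorem frame_riemSpray (x y : ι → ℝ) :
    S.frame x (S.riemSpray x y) = -(S.B S.Z (S.frame x y)) • S.J y := by
  rw [riemSpray, map_smul, map_add, map_smul, frame_Z, S.frame_apply x (S.J y), sub_add_cancel]

variable [DecidableEq ι]

theorem pdy_metric_sq (l : ι) (x : ι → ℝ) {y : ι → ℝ} (hy : y ≠ 0) :
    pdy l (fun x y => S.metric x y ^ 2) x y =
      2 * S.metric x y * S.metricDeriv x y (Pi.single l 1) := by
  unfold pdy
  rw [((S.hasFDerivAt_metric_right x hy).pow 2).fderiv]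
  simp

theorem pdx_metric_sq (l : ι) (x : ι → ℝ) {y : ι → ℝ} (hy : y ≠ 0) :
    pdx l (fun x y => S.metric x y ^ 2) x y =
      2 * S.metric x y * (S.Ω y (Pi.single l 1) * S.B (S.frame x y) S.Z * (S.alpha x y)⁻¹) := by
  unfold pdx
  rw [((S.hasFDerivAt_metric_left x hy).pow 2).fderiv]
  simp [S.Ω_swap y]
  left
  ring

theorem fundamentalTensor_metric (x : ι → ℝ) {y : ι → ℝ} (hy : y ≠ 0) :
    fundamentalTensor S.metric x y =
      Matrix.of fun i j => S.tensor x y (Pi.single i 1) (Pi.single j 1) := by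
  ext i j
  simp only [fundamentalTensor, Matrix.of_apply]
  have h1 : (fun y => pdy j (fun x y => S.metric x y ^ 2) x y) =ᶠ[nhds y]
      fun y => 2 * S.metric x y * S.metricDeriv x y (Pi.single j 1) :=
    (eventually_ne_nhds hy).mono fun z hz => S.pdy_metric_sq j x hz
  rw [pdy, h1.fderiv_eq, (((S.hasFDerivAt_metric_right x hy).const_mul 2).fun_mul
    (S.hasFDerivAt_metricDeriv_right x hy (Pi.single j 1))).fderiv, tensor_apply,
    S.B_symm (S.frame x (Pi.single i 1))]
  simp
  ring

theorem isUnit_det_fundamentalTensor (x : ι → ℝ) {y : ι → ℝ} (hy : y ≠ 0) :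
    IsUnit (fundamentalTensor S.metric x y).det := by
  rw [← Matrix.isUnit_iff_isUnit_det, ← Matrix.mulVec_injective_iff_isUnit]
  refine (injective_iff_map_eq_zero (Matrix.mulVecLin (fundamentalTensor S.metric x y))).2
    fun v hv => ?_
  by_contra hne
  refine (S.tensor_self_pos x hy hne).ne' ?_
  have h1 : ∀ i, S.tensor x y v (Pi.single i 1) = 0 := fun i => by
    have := congrFun hv i
    simp only [Matrix.mulVecLin_apply, Matrix.mulVec, dotProduct, S.fundamentalTensor_metric x hy,
      Matrix.of_apply, sum_apply_single_mul, Pi.zero_apply] at this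
    rw [S.tensor_symm, this]
  rw [← sum_apply_single_mul]
  simp [h1]

/-- The candidate is verified rather than derived: lowering its index with the fundamental tensor
gives the right-hand side of the spray equation, and the tensor is invertible. -/
theorem spray_metric (x : ι → ℝ) {y : ι → ℝ} (hy : y ≠ 0) (i : ι) :
    spray S.metric i x y = S.riemSpray x y i + S.projFactor x y * y i := by
  have hα := (S.alpha_pos x hy).ne'
  have hF := (S.metric_pos x hy).ne'
  set W : ι → ℝ := S.riemSpray x y + S.projFactor x y • y with hW
  have hV : ∀ l, (∑ k, pdx k (pdy l (fun x y => S.metric x y ^ 2)) x y * y k)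
      - pdx l (fun x y => S.metric x y ^ 2) x y =
      (fundamentalTensor S.metric x y).mulVec ((4 : ℝ) • W) l := by
    intro l
    have h1 : (fun x => pdy l (fun x y => S.metric x y ^ 2) x y) =
        fun x => 2 * S.metric x y * S.metricDeriv x y (Pi.single l 1) :=
      funext fun x => S.pdy_metric_sq l x hy
    have h2 := ((S.hasFDerivAt_metric_left x hy).const_mul 2).fun_mul
      (S.hasFDerivAt_metricDeriv_left x hy (Pi.single l 1))
    simp only [pdx, Matrix.mulVec, dotProduct, S.fundamentalTensor_metric x hy, Matrix.of_apply]
    rw [sum_apply_single_mul, sum_apply_single_mul]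
    have h3 := S.pdx_metric_sq l x hy
    simp only [pdx] at h3
    rw [h3, h1]
    rw [h2.fderiv]
    have hfW : S.frame x W = -(S.B S.Z (S.frame x y)) • S.J y + S.projFactor x y • S.frame x y := by
      rw [hW, map_add, map_smul, frame_riemSpray]
    have hbW : S.B S.X W = -(S.B S.Z (S.frame x y)) * S.Ω y S.X
        + S.projFactor x y * S.B S.X y := by
      rw [← S.B_X_frame x, hfW]
      simp [S.B_J_right, S.B_X_frame]
    have hyW : S.B (S.frame x y) (S.frame x W) = S.projFactor x y * S.alpha x y ^ 2 := by
      rw [hfW, S.alpha_sq]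
      simp [S.B_J_right, S.Ω_frame, S.Ω_self]
    -- This condition fixes the projective factor: it reads `P F = Ω(y, X) B(Z, u)`.
    have hdW : S.metricDeriv x y W = 0 := by
      rw [metricDeriv_apply, hyW, hbW, projFactor, metric]
      rw [metric] at hF
      field_simp
      ring
    rw [map_smul, smul_eq_mul, tensor_apply, hdW, hyW, S.B_symm _ (S.frame x W), hfW]
    simp [S.Ω_self, S.B_J, S.Ω_frame, S.B_symm S.Z (S.frame x y)]
    field_simp
    ring
  unfold spray
  simp only [hV]
  have h4 : ∑ l, (fundamentalTensor S.metric x y)⁻¹ i l *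
      (fundamentalTensor S.metric x y).mulVec ((4 : ℝ) • W) l = 4 * W i := by
    change (fundamentalTensor S.metric x y)⁻¹.mulVec
      ((fundamentalTensor S.metric x y).mulVec ((4 : ℝ) • W)) i = _
    rw [Matrix.mulVec_mulVec, Matrix.nonsing_inv_mul _ (S.isUnit_det_fundamentalTensor x hy),
      Matrix.one_mulVec]
    simp
  rw [h4, hW]
  simp

end TwoStepRanders

end Finsler

/-! ### Traces of the spray derivatives and the Ricci curvature at the unit. -/

namespace Finsler

namespace TwoStepRanders

variable {ι : Type} [Fintype ι] (S : TwoStepRanders ι)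

/-- The differential of the projective factor along the fibre. -/
def projDeriv (x y : ι → ℝ) : (ι → ℝ) →L[ℝ] ℝ :=
  (S.metric x y)⁻¹ • (S.B S.Z (S.frame x y) • S.Ω.flip S.X
      + S.Ω y S.X • (S.B S.Z).comp (S.frame x))
    - (S.Ω y S.X * S.B S.Z (S.frame x y) * (S.metric x y)⁻¹ ^ 2) • S.metricDeriv x y

theorem projDeriv_apply (x y w : ι → ℝ) : S.projDeriv x y w =
    (S.metric x y)⁻¹ * (S.B S.Z (S.frame x y) * S.Ω w S.X + S.Ω y S.X * S.B S.Z (S.frame x w))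
      - S.Ω y S.X * S.B S.Z (S.frame x y) * (S.metric x y)⁻¹ ^ 2 * S.metricDeriv x y w := by
  simp [projDeriv, mul_add]

theorem hasFDerivAt_projFactor_right (x : ι → ℝ) {y : ι → ℝ} (hy : y ≠ 0) :
    HasFDerivAt (fun y => S.projFactor x y) (S.projDeriv x y) y := by
  have hF := (S.metric_pos x hy).ne'
  have h1 := ((S.Ω.flip S.X).hasFDerivAt (x := y)).fun_mul
    ((S.B S.Z).comp (S.frame x)).hasFDerivAt
  have h2 := h1.fun_mul (hasFDerivAt_inv_comp (S.hasFDerivAt_metric_right x hy) hF)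
  refine h2.congr_fderiv ?_
  ext w
  simp [projDeriv_apply]
  field_simp
  ring

/-- The point `x` enters only through `Ω x y`. The coefficient is left unnamed because every later
use pairs the differential with `y`, and `Ω y y = 0`. -/
theorem exists_hasFDerivAt_projFactor_left (x : ι → ℝ) {y : ι → ℝ} (hy : y ≠ 0) :
    ∃ c : ℝ, HasFDerivAt (fun x => S.projFactor x y) (c • S.Ω.flip y) x := by
  have hF := (S.metric_pos x hy).ne'
  have h1 := (((S.B S.Z).hasFDerivAt.comp x (S.hasFDerivAt_frame_left x y)).const_mul
    (S.Ω y S.X)).fun_mul (hasFDerivAt_inv_comp (S.hasFDerivAt_metric_left x hy) hF)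
  refine ⟨S.Ω y S.X * S.B S.Z (S.frame x y) * (S.metric x y ^ 2)⁻¹ * (S.alpha x y)⁻¹ *
    S.B (S.frame x y) S.Z - (S.metric x y)⁻¹ * S.Ω y S.X * S.B S.Z S.Z, h1.congr_fderiv ?_⟩
  ext w
  simp
  ring

theorem metricDeriv_self (x : ι → ℝ) {y : ι → ℝ} (hy : y ≠ 0) :
    S.metricDeriv x y y = S.metric x y := by
  have hα := (S.alpha_pos x hy).ne'
  rw [metricDeriv_apply, ← S.alpha_sq, metric]
  field_simp

/-- Euler's identity: the projective factor is homogeneous of degree one in `y`. -/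
theorem projDeriv_self (x : ι → ℝ) {y : ι → ℝ} (hy : y ≠ 0) :
    S.projDeriv x y y = S.projFactor x y := by
  have hF := (S.metric_pos x hy).ne'
  rw [projDeriv_apply, S.metricDeriv_self x hy, projFactor]
  field_simp
  ring

/-- The differential along the fibre of the spray of the Riemannian part. -/
def riemDeriv (x y : ι → ℝ) : (ι → ℝ) →L[ℝ] (ι → ℝ) :=
  -(S.B S.Z (S.frame x y)) • (S.J + ((S.Ω x).comp S.J).smulRight S.Z)
    - ((S.B S.Z).comp (S.frame x)).smulRight (S.J y + S.Ω x (S.J y) • S.Z)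

theorem riemDeriv_apply (x y w : ι → ℝ) : S.riemDeriv x y w =
    -(S.B S.Z (S.frame x y)) • (S.J w + S.Ω x (S.J w) • S.Z)
      - S.B S.Z (S.frame x w) • (S.J y + S.Ω x (S.J y) • S.Z) := by
  simp [riemDeriv]

theorem hasFDerivAt_riemSpray_right (x y : ι → ℝ) :
    HasFDerivAt (fun y => S.riemSpray x y) (S.riemDeriv x y) y := by
  have h1 := (((S.B S.Z).comp (S.frame x)).hasFDerivAt (x := y)).fun_neg.fun_smul
    (S.J + ((S.Ω x).comp S.J).smulRight S.Z).hasFDerivAt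
  refine h1.congr_fderiv ?_
  ext w i
  simp [riemDeriv_apply]
  ring

theorem hasFDerivAt_riemSpray_left (x y : ι → ℝ) :
    HasFDerivAt (fun x => S.riemSpray x y)
      (S.B S.Z S.Z • (S.Ω.flip y).smulRight (S.J y + S.Ω x (S.J y) • S.Z)
        - S.B S.Z (S.frame x y) • (S.Ω.flip (S.J y)).smulRight S.Z) x := by
  have h1 := ((S.B S.Z).hasFDerivAt.comp x (S.hasFDerivAt_frame_left x y)).fun_neg.fun_smul
    ((((S.Ω.flip (S.J y)).hasFDerivAt (x := x)).smul_const S.Z).const_add (S.J y))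
  refine h1.congr_fderiv ?_
  ext w i
  simp
  ring

/-- The differential of the spray along the fibre. -/
def sprayDeriv (x y : ι → ℝ) : (ι → ℝ) →L[ℝ] (ι → ℝ) :=
  S.riemDeriv x y + (S.projFactor x y • ContinuousLinearMap.id ℝ _ + (S.projDeriv x y).smulRight y)

theorem sprayDeriv_apply (x y w : ι → ℝ) : S.sprayDeriv x y w =
    S.riemDeriv x y w + (S.projFactor x y • w + S.projDeriv x y w • y) := by
  simp [sprayDeriv]

theorem hasFDerivAt_spray_right (x : ι → ℝ) {y : ι → ℝ} (hy : y ≠ 0) :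
    HasFDerivAt (fun y => S.riemSpray x y + S.projFactor x y • y) (S.sprayDeriv x y) y :=
  (S.hasFDerivAt_riemSpray_right x y).fun_add
    ((S.hasFDerivAt_projFactor_right x hy).fun_smul (hasFDerivAt_id y))

theorem differentiableAt_sprayDeriv_right (x : ι → ℝ) {y : ι → ℝ} (hy : y ≠ 0) (w : ι → ℝ) :
    DifferentiableAt ℝ (fun y => S.sprayDeriv x y w) y := by
  have hF := (S.metric_pos x hy).ne'
  have h1 := (S.hasFDerivAt_metric_right x hy).differentiableAt
  have h2 := (S.hasFDerivAt_metricDeriv_right x hy w).differentiableAt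
  have h3 := (S.hasFDerivAt_projFactor_right x hy).differentiableAt
  simp only [sprayDeriv_apply, riemDeriv_apply, projDeriv_apply]
  fun_prop (disch := assumption)

theorem differentiableAt_sprayDeriv_left (x : ι → ℝ) {y : ι → ℝ} (hy : y ≠ 0) (w : ι → ℝ) :
    DifferentiableAt ℝ (fun x => S.sprayDeriv x y w) x := by
  have hF := (S.metric_pos x hy).ne'
  have h1 := (S.hasFDerivAt_metric_left x hy).differentiableAt
  have h2 := (S.hasFDerivAt_metricDeriv_left x hy w).differentiableAt
  obtain ⟨c, hc⟩ := S.exists_hasFDerivAt_projFactor_left x hy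
  have h3 := hc.differentiableAt
  simp only [sprayDeriv_apply, riemDeriv_apply, projDeriv_apply, frame_apply]
  fun_prop (disch := assumption)

/-- The combination through which the projective factor enters the Ricci curvature. -/
theorem projFactor_sq_add {y : ι → ℝ} (hy : y ≠ 0) :
    S.projFactor 0 y ^ 2 + 2 * S.projDeriv 0 y (S.riemSpray 0 y) =
      3 * S.Ω y S.X ^ 2 * S.B S.Z y ^ 2 / S.metric 0 y ^ 2
        - 2 * S.B S.Z y ^ 2 * S.Ω (S.J y) S.X / S.metric 0 y := by
  have hF := (S.metric_pos 0 hy).ne'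
  have hr0 : S.riemSpray 0 y = -(S.B S.Z y) • S.J y := by simp [riemSpray, frame_zero]
  rw [hr0, map_smul, projDeriv_apply, metricDeriv_apply, projFactor]
  simp [frame_zero, S.B_J_right, S.Ω_Z, S.Ω_self]
  field_simp
  ring

variable [DecidableEq ι]

/-- The trace of the differential of the spray along the fibre. -/
theorem sum_sprayDeriv (x : ι → ℝ) {y : ι → ℝ} (hy : y ≠ 0) :
    ∑ i, S.sprayDeriv x y (Pi.single i 1) i =
      -(∑ i, S.J (Pi.single i 1) i) * S.B S.Z (S.frame x y)
        + (Fintype.card ι + 1) * S.projFactor x y := by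
  have h1 : ∀ v, S.B S.Z (S.J v) = 0 := fun v => by rw [S.B_J_right, S.Ω_Z]
  -- The trace of a rank-one term is its functional evaluated at its vector. The next two vanish
  -- since `J Z = 0` and the image of `J` is orthogonal to `Z`.
  have e1 : ∑ i, S.Ω x (S.J (Pi.single i 1)) * S.Z i = 0 := by
    have := sum_apply_single_mul ((S.Ω x).comp S.J) S.Z
    simpa [S.J_Z] using this
  have e2 : ∑ i, S.B S.Z (S.frame x (Pi.single i 1)) * (S.J y + S.Ω x (S.J y) • S.Z) i = 0 := by
    have := sum_apply_single_mul ((S.B S.Z).comp (S.frame x)) (S.J y + S.Ω x (S.J y) • S.Z)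
    refine this.trans ?_
    simp [frame_apply, h1, S.Ω_Z]
  have e3 := sum_apply_single_mul (S.projDeriv x y) y
  rw [S.projDeriv_self x hy] at e3
  have e4 : ∑ i, S.sprayDeriv x y (Pi.single i 1) i =
      ∑ i, (-(S.B S.Z (S.frame x y)) * S.J (Pi.single i 1) i
        - S.B S.Z (S.frame x y) * (S.Ω x (S.J (Pi.single i 1)) * S.Z i)
        - S.B S.Z (S.frame x (Pi.single i 1)) * (S.J y + S.Ω x (S.J y) • S.Z) i
        + S.projFactor x y + S.projDeriv x y (Pi.single i 1) * y i) := by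
    refine Finset.sum_congr rfl fun i _ => ?_
    simp [sprayDeriv_apply, riemDeriv_apply]
    ring
  rw [e4, Finset.sum_add_distrib, Finset.sum_add_distrib, Finset.sum_sub_distrib,
    Finset.sum_sub_distrib, e3, e2, ← Finset.mul_sum, ← Finset.mul_sum, e1]
  simp
  ring

theorem pdy_spray (i k : ι) (x : ι → ℝ) {y : ι → ℝ} (hy : y ≠ 0) :
    pdy k (spray S.metric i) x y = S.sprayDeriv x y (Pi.single k 1) i := by
  have h1 : (fun y => spray S.metric i x y) =ᶠ[nhds y]
      fun y => (S.riemSpray x y + S.projFactor x y • y) i :=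
    (eventually_ne_nhds hy).mono fun z hz => by simp [S.spray_metric x hz]
  rw [pdy, h1.fderiv_eq, (hasFDerivAt_pi'.1 (S.hasFDerivAt_spray_right x hy) i).fderiv]
  rfl

theorem sum_pdx_spray {y : ι → ℝ} (hy : y ≠ 0) :
    ∑ i, pdx i (spray S.metric i) 0 y = S.B S.Z S.Z * S.Ω (S.J y) y := by
  obtain ⟨c, hc⟩ := S.exists_hasFDerivAt_projFactor_left 0 hy
  have h2 : ∀ i, pdx i (spray S.metric i) 0 y =
      S.B S.Z S.Z * (S.Ω (Pi.single i 1) y * S.J y i)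
        - S.B S.Z y * (S.Ω (Pi.single i 1) (S.J y) * S.Z i)
        + c * (S.Ω (Pi.single i 1) y * y i) := by
    intro i
    have h1 : (fun x => spray S.metric i x y) =
        fun x => (S.riemSpray x y + S.projFactor x y • y) i :=
      funext fun x => by simp [S.spray_metric x hy]
    rw [pdx, h1, (hasFDerivAt_pi'.1 ((S.hasFDerivAt_riemSpray_left 0 y).fun_add
      (hc.smul_const y)) i).fderiv]
    simp [frame_zero]
    ring
  have e := fun z w => sum_apply_single_mul (S.Ω.flip z) w
  simp only [ContinuousLinearMap.flip_apply] at e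
  simp only [h2, Finset.sum_add_distrib, Finset.sum_sub_distrib, ← Finset.mul_sum, e,
    S.Ω_self, S.Ω_Z_left]
  ring

/-- Exchanging trace and derivative turns the sum into the `x`-derivative, in direction `y`, of the
fibre trace of the spray. That trace depends on `x` only through `Ω x y`, and `Ω y y = 0`. -/
theorem sum_mul_pdx_pdy_spray {y : ι → ℝ} (hy : y ≠ 0) :
    ∑ i, ∑ j, y j * pdx j (pdy i (spray S.metric i)) 0 y = 0 := by
  have h1 : ∀ i, ∑ j, y j * pdx j (pdy i (spray S.metric i)) 0 y =
      fderiv ℝ (fun x => S.sprayDeriv x y (Pi.single i 1) i) 0 y := by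
    intro i
    have h : (fun x => pdy i (spray S.metric i) x y) =
        fun x => S.sprayDeriv x y (Pi.single i 1) i := funext fun x => S.pdy_spray i i x hy
    simp only [pdx, h]
    rw [← sum_apply_single_mul]
    exact Finset.sum_congr rfl fun j _ => mul_comm _ _
  simp only [h1]
  rw [← sum_apply, ← fderiv_fun_sum fun i _ =>
    differentiableAt_pi.1 (S.differentiableAt_sprayDeriv_left 0 hy (Pi.single i 1)) i]
  obtain ⟨c, hc⟩ := S.exists_hasFDerivAt_projFactor_left 0 hy
  simp only [S.sum_sprayDeriv _ hy]
  have h2 := (((S.B S.Z).hasFDerivAt.comp 0 (S.hasFDerivAt_frame_left 0 y)).const_mul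
    (-(∑ i, S.J (Pi.single i 1) i))).fun_add (hc.const_mul ((Fintype.card ι : ℝ) + 1))
  have h3 := h2.fderiv
  simp only [Function.comp_def] at h3
  rw [h3]
  simp [S.Ω_self]

/-- The same exchange: the fibre trace is differentiated in the direction of the spray itself. Its
Riemannian part is orthogonal to `Z`, so the `tr J` term sees only `P y`. -/
theorem sum_spray_mul_pdy_pdy_spray {y : ι → ℝ} (hy : y ≠ 0) :
    ∑ i, ∑ j, spray S.metric j 0 y * pdy j (pdy i (spray S.metric i)) 0 y =
      -(∑ i, S.J (Pi.single i 1) i) * (S.projFactor 0 y * S.B S.Z y)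
        + (Fintype.card ι + 1) * (S.projDeriv 0 y (S.riemSpray 0 y) + S.projFactor 0 y ^ 2) := by
  set W := S.riemSpray 0 y + S.projFactor 0 y • y with hW
  have h1 : ∀ i, ∑ j, spray S.metric j 0 y * pdy j (pdy i (spray S.metric i)) 0 y =
      fderiv ℝ (fun y => S.sprayDeriv 0 y (Pi.single i 1) i) y W := by
    intro i
    have h : (fun y => pdy i (spray S.metric i) 0 y) =ᶠ[nhds y]
        fun y => S.sprayDeriv 0 y (Pi.single i 1) i :=
      (eventually_ne_nhds hy).mono fun z hz => S.pdy_spray i i 0 hz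
    rw [← sum_apply_single_mul]
    refine Finset.sum_congr rfl fun j _ => ?_
    rw [pdy, h.fderiv_eq, S.spray_metric 0 hy, mul_comm]
    rfl
  simp only [h1]
  rw [← sum_apply, ← fderiv_fun_sum fun i _ =>
    differentiableAt_pi.1 (S.differentiableAt_sprayDeriv_right 0 hy (Pi.single i 1)) i]
  have h2 : (fun y => ∑ i, S.sprayDeriv 0 y (Pi.single i 1) i) =ᶠ[nhds y]
      fun y => -(∑ i, S.J (Pi.single i 1) i) * ((S.B S.Z).comp (S.frame 0)) y
        + (Fintype.card ι + 1) * S.projFactor 0 y :=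
    (eventually_ne_nhds hy).mono fun z hz => S.sum_sprayDeriv 0 hz
  rw [h2.fderiv_eq, ((((S.B S.Z).comp (S.frame 0)).hasFDerivAt.const_mul _).fun_add
    ((S.hasFDerivAt_projFactor_right 0 hy).const_mul _)).fderiv]
  simp [hW, S.projDeriv_self 0 hy, frame_zero, riemSpray, S.B_J_right, S.Ω_Z]
  left
  ring

theorem sum_pdy_spray_mul_pdy_spray {y : ι → ℝ} (hy : y ≠ 0) :
    ∑ i, ∑ j, pdy j (spray S.metric i) 0 y * pdy i (spray S.metric j) 0 y =
      S.B S.Z y ^ 2 * ∑ i, S.J (S.J (Pi.single i 1)) i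
        - 2 * (S.projFactor 0 y * S.B S.Z y * ∑ i, S.J (Pi.single i 1) i)
        + (Fintype.card ι + 3) * S.projFactor 0 y ^ 2
        + 4 * S.projDeriv 0 y (S.riemSpray 0 y) := by
  have h1 : ∀ i, ∑ j, pdy j (spray S.metric i) 0 y * pdy i (spray S.metric j) 0 y =
      S.sprayDeriv 0 y (S.sprayDeriv 0 y (Pi.single i 1)) i := by
    intro i
    simp only [S.pdy_spray _ _ 0 hy]
    exact sum_apply_single_mul ((ContinuousLinearMap.proj i).comp (S.sprayDeriv 0 y)) _
  have hZJ : ∀ v, S.B S.Z (S.J v) = 0 := fun v => by rw [S.B_J_right, S.Ω_Z]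
  have hr : ∀ w, S.riemDeriv 0 y w = -(S.B S.Z y) • S.J w - S.B S.Z w • S.J y := fun w => by
    simp [riemDeriv_apply, frame_zero]
  have hr0 : S.riemSpray 0 y = -(S.B S.Z y) • S.J y := by simp [riemSpray, frame_zero]
  -- The squared fibre differential is expanded so that each summand is a diagonal entry of an
  -- endomorphism whose trace is kept (`J`, `J²`, the identity) or of a rank-one map.
  have h2 : ∀ i, S.sprayDeriv 0 y (S.sprayDeriv 0 y (Pi.single i 1)) i =
      S.B S.Z y ^ 2 * S.J (S.J (Pi.single i 1)) i
        + S.B S.Z y * (S.B S.Z (Pi.single i 1) * S.J (S.J y) i)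
        - 2 * S.projFactor 0 y * S.B S.Z y * S.J (Pi.single i 1) i
        - 2 * S.projFactor 0 y * (S.B S.Z (Pi.single i 1) * S.J y i)
        + S.projFactor 0 y ^ 2
        + 2 * (S.projDeriv 0 y (Pi.single i 1) * (S.riemSpray 0 y) i)
        + 3 * S.projFactor 0 y * (S.projDeriv 0 y (Pi.single i 1) * y i)
        + (S.projDeriv 0 y).comp (S.riemDeriv 0 y) (Pi.single i 1) * y i := by
    intro i
    rw [sprayDeriv_apply, sprayDeriv_apply, ContinuousLinearMap.comp_apply]
    simp only [map_add, map_smul, S.projDeriv_self 0 hy]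
    rw [hr (S.riemDeriv 0 y (Pi.single i 1)), hr y, hr (Pi.single i 1), hr0]
    simp [hZJ]
    ring
  -- Euler's identity in degree two.
  have h3 : S.riemDeriv 0 y y = (2 : ℝ) • S.riemSpray 0 y := by
    rw [hr, hr0]
    module
  simp only [h1, h2, Finset.sum_add_distrib, Finset.sum_sub_distrib, ← Finset.mul_sum,
    sum_apply_single_mul]
  simp [hZJ, S.projDeriv_self 0 hy, h3]
  ring

/-- The Ricci curvature at the unit. -/
theorem ricci_metric_zero {y : ι → ℝ} (hy : y ≠ 0) :
    ricci S.metric 0 y =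
      2 * S.B S.Z S.Z * S.Ω (S.J y) y - S.B S.Z y ^ 2 * ∑ i, S.J (S.J (Pi.single i 1)) i
        + (Fintype.card ι - 1) * (3 * S.Ω y S.X ^ 2 * S.B S.Z y ^ 2 / S.metric 0 y ^ 2
          - 2 * S.B S.Z y ^ 2 * S.Ω (S.J y) S.X / S.metric 0 y) := by
  simp only [ricci, riemannCurvature, Matrix.trace, Matrix.diag_apply, Matrix.of_apply,
    Finset.sum_add_distrib, Finset.sum_sub_distrib, ← Finset.mul_sum]
  rw [S.sum_pdx_spray hy, S.sum_mul_pdx_pdy_spray hy, S.sum_spray_mul_pdy_pdy_spray hy,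
    S.sum_pdy_spray_mul_pdy_spray hy, ← S.projFactor_sq_add hy]
  ring

end TwoStepRanders

end Finsler

/-! ### The Ricci curvature of the model is not quadratic. -/

namespace Finsler

namespace TwoStepRanders

variable {ι : Type} [Fintype ι] (S : TwoStepRanders ι)

/-- A vector orthogonal to `X` and `Z` that pairs with `X` under `Ω`. -/
theorem exists_orthogonal (hZ : S.Z ≠ 0) (hX : ∃ v, S.Ω v S.X ≠ 0) :
    ∃ v, S.B S.X v = 0 ∧ S.B S.Z v = 0 ∧ S.Ω v S.X ≠ 0 := by
  obtain ⟨v, hv⟩ := hX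
  have hX0 : S.X ≠ 0 := fun h => hv (by rw [h, map_zero])
  have hXX := (S.B_pos _ hX0).ne'
  have hZZ := (S.B_pos _ hZ).ne'
  -- Gram–Schmidt against the orthogonal pair `X`, `Z`; the value of `Ω · X` is unchanged since `Ω X
  -- X = Ω Z X = 0`.
  refine ⟨v - (S.B S.X v / S.B S.X S.X) • S.X - (S.B S.Z v / S.B S.Z S.Z) • S.Z, ?_, ?_, ?_⟩
  · simp [S.B_X_Z]
    field_simp
    ring
  · simp [S.B_Z_X]
    field_simp
    ring
  · simpa [S.Ω_self, S.Ω_Z_left] using hv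

variable [DecidableEq ι]

theorem not_isRicciQuadratic (hZ : S.Z ≠ 0) (hX : ∃ v, S.Ω v S.X ≠ 0)
    (hcard : 1 < Fintype.card ι) : ¬ IsRicciQuadratic S.metric := by
  intro hRic
  obtain ⟨q, hq⟩ := hRic 0
  obtain ⟨v, hXv, hZv, hΩ⟩ := S.exists_orthogonal hZ hX
  have hv : v ≠ 0 := fun h => hΩ (by simp [h])
  have hA := S.B_pos v hv
  have hC := S.B_pos _ hZ
  set A := S.B v v with hAdef
  set C := S.B S.Z S.Z with hCdef
  set τ := ∑ i, S.J (S.J (Pi.single i 1)) i with hτ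
  have hk : (0 : ℝ) < Fintype.card ι - 1 := by
    have : (1 : ℝ) < Fintype.card ι := by exact_mod_cast hcard
    linarith
  set k : ℝ := Fintype.card ι - 1 with hkdef
  -- Average of the curvature formula over `±(v + t Z)`: `F` agrees at both, so the term in `Ω (J y)
  -- X / F`, odd in `y`, cancels.
  have hval : ∀ t : ℝ, q (v + t • S.Z) = 2 * C * S.Ω (S.J v) v - t ^ 2 * (C ^ 2 * τ)
      + t ^ 2 * (3 * k * S.Ω v S.X ^ 2 * C ^ 2) / (A + t ^ 2 * C) := by
    intro t
    have hne : v + t • S.Z ≠ 0 := fun h => hΩ (by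
      have := congrArg (fun w => S.Ω w S.X) h
      simpa [S.Ω_Z_left] using this)
    have hα : S.alpha 0 (v + t • S.Z) = √(A + t ^ 2 * C) := by
      rw [alpha, frame_zero]
      congr 1
      simp [hZv, S.B_symm v S.Z, ← hAdef, ← hCdef]
      ring
    have hα' : S.alpha 0 (-(v + t • S.Z)) = √(A + t ^ 2 * C) := by
      rw [← hα, alpha, alpha, frame_zero, frame_zero, map_neg, map_neg, neg_apply, neg_neg]
    have hpos : 0 < A + t ^ 2 * C := by positivity
    have hs : √(A + t ^ 2 * C) ^ 2 = A + t ^ 2 * C := Real.sq_sqrt hpos.le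
    have h1 := hq _ hne
    have h2 := hq _ (neg_ne_zero.2 hne)
    rw [S.ricci_metric_zero hne, metric, hα] at h1
    rw [S.ricci_metric_zero (neg_ne_zero.2 hne), metric, hα', QuadraticMap.map_neg] at h2
    simp [S.B_X_Z, hXv, hZv, S.J_Z, S.Ω_Z, S.Ω_Z_left, hs, ← hCdef, ← hτ, ← hkdef] at h1 h2
    have h3 : q (v + t • S.Z) = (q (v + t • S.Z) + q (v + t • S.Z)) / 2 := by ring
    rw [h3]
    nth_rewrite 1 [← h1]
    rw [← h2]
    ring
  have hexp : ∀ t : ℝ, q (v + t • S.Z) = q v + t * QuadraticMap.polar q v S.Z + t ^ 2 * q S.Z := by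
    intro t
    rw [QuadraticMap.map_add q, QuadraticMap.map_smul, QuadraticMap.polar_smul_right]
    simp only [smul_eq_mul]
    ring
  set D := 3 * k * S.Ω v S.X ^ 2 * C ^ 2 with hD
  have hDpos : 0 < D := by positivity
  -- The values at `0` and `±1` determine the quadratic polynomial; the value at `2` overdetermines
  -- it and forces `D / (A + C) = D / (A + 4 C)`.
  have e0 := (hexp 0).symm.trans (hval 0)
  have e1 := (hexp 1).symm.trans (hval 1)
  have e2 := (hexp (-1)).symm.trans (hval (-1))
  have e3 := (hexp 2).symm.trans (hval 2)
  norm_num at e0 e1 e2 e3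
  have e4 : D / (A + C) = D / (A + 4 * C) := by
    rw [mul_div_assoc] at e3
    linarith
  rw [div_eq_div_iff (by positivity) (by positivity)] at e4
  nlinarith [mul_pos hDpos hC]

end TwoStepRanders

end Finsler

/-! ### Reduction of the Heisenberg group to the model. -/

namespace Heisenberg

open Finsler

variable {n : ℕ}

/-- The symplectic form as a continuous bilinear map. -/
def omegaCLM : (Idx n → ℝ) →L[ℝ] (Idx n → ℝ) →L[ℝ] ℝ :=
  LinearMap.toContinuousBilinearMap <| LinearMap.mk₂ ℝ omega
    (fun a b c => by
      simp only [omega, ← Finset.sum_add_distrib, Pi.add_apply]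
      exact Finset.sum_congr rfl fun i _ => by ring)
    (fun r a b => by
      simp only [omega, smul_eq_mul, Finset.mul_sum, Pi.smul_apply]
      exact Finset.sum_congr rfl fun i _ => by ring)
    (fun a b c => by
      simp only [omega, ← Finset.sum_add_distrib, Pi.add_apply]
      exact Finset.sum_congr rfl fun i _ => by ring)
    (fun r a b => by
      simp only [omega, smul_eq_mul, Finset.mul_sum, Pi.smul_apply]
      exact Finset.sum_congr rfl fun i _ => by ring)

theorem omegaCLM_apply (a b : Idx n → ℝ) : omegaCLM a b = omega a b := rfl

theorem omega_self (a : Idx n → ℝ) : omega a a = 0 :=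
  Finset.sum_eq_zero fun i _ => by ring

/-- The central direction. -/
def center : Idx n → ℝ := Pi.single (Sum.inr ()) 1

theorem center_inl (k : Fin n ⊕ Fin n) : (center : Idx n → ℝ) (Sum.inl k) = 0 := by
  simp [center]

theorem center_inr (u : Unit) : (center : Idx n → ℝ) (Sum.inr u) = 1 := by
  simp [center]

theorem center_ne_zero : (center : Idx n → ℝ) ≠ 0 := fun h => by
  simpa [center_inr] using congrFun h (Sum.inr ())

theorem omega_center (a : Idx n → ℝ) : omega a center = 0 := by
  simp [omega, center_inl]

theorem exists_omega_ne_zero {a : Idx n → ℝ} {k : Fin n ⊕ Fin n} (h : a (Sum.inl k) ≠ 0) :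
    ∃ v, omega v a ≠ 0 := by
  rcases k with i | i
  · refine ⟨Pi.single (Sum.inl (Sum.inr i)) 1, ?_⟩
    simpa [omega, Pi.single_apply] using h
  · refine ⟨Pi.single (Sum.inl (Sum.inl i)) 1, ?_⟩
    simpa [omega, Pi.single_apply] using h

theorem fderiv_mul_inv (a v : Idx n → ℝ) :
    fderiv ℝ (mul (inv a)) a v = v - omega a v • center := by
  have h : mul (inv a) = fun b => (b - omegaCLM a b • center) - a := by
    funext b k
    rcases k with k | u
    · simp [mul, inv, center_inl]
      ring
    · simp only [mul, inv, Sum.elim_inr, Pi.sub_apply, Pi.smul_apply, center_inr, smul_eq_mul,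
        omegaCLM_apply, omega, mul_one, neg_mul, sub_neg_eq_add, Finset.sum_add_distrib,
        Finset.sum_sub_distrib, Finset.sum_neg_distrib]
      ring
  have h1 : HasFDerivAt (fun b => (b - omegaCLM a b • center) - a)
      (ContinuousLinearMap.id ℝ _ - (omegaCLM a).smulRight center) a :=
    ((hasFDerivAt_id a).fun_sub ((omegaCLM a).hasFDerivAt.smul_const center)).sub_const a
  rw [h, h1.fderiv]
  simp [omegaCLM_apply]

/-- The bilinear form of a matrix as a continuous bilinear map. -/
def formCLM (A : Matrix (Idx n) (Idx n) ℝ) : (Idx n → ℝ) →L[ℝ] (Idx n → ℝ) →L[ℝ] ℝ :=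
  LinearMap.toContinuousBilinearMap (Matrix.toLinearMap₂' ℝ A)

theorem formCLM_apply (A : Matrix (Idx n) (Idx n) ℝ) (v w : Idx n → ℝ) :
    formCLM A v w = v ⬝ᵥ A.mulVec w :=
  Matrix.toLinearMap₂'_apply' A v w

theorem formCLM_symm {A : Matrix (Idx n) (Idx n) ℝ} (hA : A.PosDef) (v w : Idx n → ℝ) :
    formCLM A v w = formCLM A w v := by
  have h : A.transpose = A := by simpa [Matrix.IsHermitian] using hA.isHermitian
  rw [formCLM_apply, formCLM_apply, Matrix.dotProduct_mulVec, ← Matrix.mulVec_transpose, h,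
    dotProduct_comm]

/-- The operator representing the symplectic form with respect to a matrix. -/
def omegaOp (A : Matrix (Idx n) (Idx n) ℝ) : (Idx n → ℝ) →L[ℝ] (Idx n → ℝ) :=
  (LinearMap.toContinuousLinearMap A⁻¹.mulVecLin).comp
    (ContinuousLinearMap.pi fun i => omegaCLM.flip (Pi.single i 1))

theorem formCLM_omegaOp {A : Matrix (Idx n) (Idx n) ℝ} (hA : A.PosDef) (v w : Idx n → ℝ) :
    formCLM A (omegaOp A v) w = omegaCLM v w := by
  rw [formCLM_symm hA, formCLM_apply]
  have h : A.mulVec (omegaOp A v) = fun i => omegaCLM v (Pi.single i 1) := by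
    simp only [omegaOp, ContinuousLinearMap.comp_apply, LinearMap.coe_toContinuousLinearMap',
      Matrix.mulVecLin_apply, Matrix.mulVec_mulVec]
    rw [Matrix.mul_nonsing_inv _ ((Matrix.isUnit_iff_isUnit_det _).1 hA.isUnit), Matrix.one_mulVec]
    rfl
  rw [h, ← sum_apply_single_mul]
  exact Finset.sum_congr rfl fun i _ => mul_comm _ _

variable (R : RandersData (Idx n))

theorem metric_eq (hinv : IsLeftInvariant R.metric) (x y : Idx n → ℝ) :
    R.metric x y = √(formCLM (R.g 0) (y - omega x y • center) (y - omega x y • center))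
      + formCLM (R.g 0) (R.X 0) (y - omega x y • center) := by
  rw [hinv, fderiv_mul_inv, RandersData.metric, formCLM_apply, formCLM_apply]

/-- The `1`-form is the odd part of `F` in `y`, so comparing `F` at `±e_j` extracts its
left-invariance from that of `F`. -/
theorem form_eq (hinv : IsLeftInvariant R.metric) (x : Idx n → ℝ) (j : Idx n) :
    R.form x j = formCLM (R.g 0) (R.X 0)
      (Pi.single j 1 - omega x (Pi.single j 1) • center) := by
  have h0 : R.form x j = R.X x ⬝ᵥ (R.g x).mulVec (Pi.single j 1) := by
    rw [← formCLM_apply, formCLM_symm (R.posDef_g x), formCLM_apply]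
    simp [RandersData.form]
  set e : Idx n → ℝ := Pi.single j 1
  have h1 := metric_eq R hinv x e
  have h2 := metric_eq R hinv x (-e)
  have h3 : omega x (-e) = -omega x e := map_neg (omegaCLM x) e
  have h4 : -e - omega x (-e) • center = -(e - omega x e • center) := by
    rw [h3]; module
  rw [h4] at h2
  simp only [RandersData.metric, Matrix.mulVec_neg, neg_dotProduct, dotProduct_neg, neg_neg,
    map_neg, neg_apply] at h1 h2
  rw [h0]
  linarith

/-- By left-invariance the exterior derivative of the form is a multiple of `ω` with factor `-2 B(X,
Z)`. Evaluating on one conjugate pair, which needs `n ≥ 1`, gives the vanishing. -/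
theorem formCLM_X_center (hn : 1 ≤ n) (hinv : IsLeftInvariant R.metric) (hD : R.IsDouglas) :
    formCLM (R.g 0) (R.X 0) center = 0 := by
  have h1 : ∀ i j, fderiv ℝ (fun x => R.form x j) 0 (Pi.single i 1) =
      -(omega (Pi.single i 1) (Pi.single j 1) * formCLM (R.g 0) (R.X 0) center) := by
    intro i j
    have h : (fun x => R.form x j) = fun x => formCLM (R.g 0) (R.X 0) (Pi.single j 1)
        - omegaCLM.flip (Pi.single j 1) x * formCLM (R.g 0) (R.X 0) center := by
      funext x
      rw [form_eq R hinv, map_sub, map_smul]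
      rfl
    rw [h, (((omegaCLM.flip (Pi.single j 1)).hasFDerivAt.mul_const _).const_sub _).fderiv]
    simp [omegaCLM_apply]
    ring
  have h2 := hD 0 (Sum.inl (Sum.inl ⟨0, hn⟩)) (Sum.inl (Sum.inr ⟨0, hn⟩))
  rw [h1, h1] at h2
  have h3 : omega (Pi.single (Sum.inl (Sum.inl ⟨0, hn⟩)) 1 : Idx n → ℝ)
      (Pi.single (Sum.inl (Sum.inr ⟨0, hn⟩)) 1) = 1 := by
    simp [omega, Pi.single_apply]
  have h4 : omega (Pi.single (Sum.inl (Sum.inr ⟨0, hn⟩)) 1 : Idx n → ℝ)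
      (Pi.single (Sum.inl (Sum.inl ⟨0, hn⟩)) 1) = -1 := by
    simp [omega, Pi.single_apply]
  rw [h3, h4] at h2
  linarith

/-- The form at every point is determined by `X` at the unit, and `g` is nondegenerate. -/
theorem X_zero_ne_zero (hX : R.X ≠ 0) (hinv : IsLeftInvariant R.metric) : R.X 0 ≠ 0 := by
  intro h
  refine hX (funext fun x => ?_)
  have h1 : R.form x = 0 := funext fun j => by simp [form_eq R hinv, h]
  by_contra hne
  have h2 := (R.posDef_g x).dotProduct_mulVec_pos hne
  rw [RandersData.form] at h1
  simp [h1] at h2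

/-- The left-invariant Randers metric of Douglas type as a two-step Randers metric. -/
def toTwoStep (hn : 1 ≤ n) (hinv : IsLeftInvariant R.metric) (hD : R.IsDouglas) :
    TwoStepRanders (Idx n) where
  B := formCLM (R.g 0)
  Ω := omegaCLM
  Z := center
  X := R.X 0
  J := omegaOp (R.g 0)
  B_symm := formCLM_symm (R.posDef_g 0)
  B_pos v hv := by
    have := (R.posDef_g 0).dotProduct_mulVec_pos hv
    simpa [formCLM_apply] using this
  Ω_self := omega_self
  Ω_Z := omega_center
  B_J := formCLM_omegaOp (R.posDef_g 0)
  B_X_Z := formCLM_X_center R hn hinv hD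
  B_X_X := by
    have h := R.norm_lt_one 0
    rwa [Real.sqrt_lt' one_pos, one_pow, ← formCLM_apply] at h

theorem toTwoStep_metric (hn : 1 ≤ n) (hinv : IsLeftInvariant R.metric) (hD : R.IsDouglas) :
    (toTwoStep R hn hinv hD).metric = R.metric := by
  funext x y
  rw [metric_eq R hinv, map_sub (formCLM (R.g 0) (R.X 0)), map_smul (formCLM (R.g 0) (R.X 0)),
    formCLM_X_center R hn hinv hD, smul_zero, sub_zero, TwoStepRanders.metric, TwoStepRanders.alpha, TwoStepRanders.frame_apply]
  rfl

end Heisenberg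

end

theorem mainTheorem2 (n : ℕ) (hn : 1 ≤ n)
    (R : Finsler.RandersData (Heisenberg.Idx n))
    (hX : R.X ≠ 0)
    (hinv : Heisenberg.IsLeftInvariant R.metric)
    (hDouglas : R.IsDouglas) :
    ¬ Finsler.IsRicciQuadratic R.metric := by
  rw [← Heisenberg.toTwoStep_metric R hn hinv hDouglas]
  refine Finsler.TwoStepRanders.not_isRicciQuadratic _ Heisenberg.center_ne_zero ?_ ?_
  · have h0 := Heisenberg.X_zero_ne_zero R hX hinv
    suffices h : ∃ k, R.X 0 (Sum.inl k) ≠ 0 from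
      h.elim fun k hk => Heisenberg.exists_omega_ne_zero hk
    -- Otherwise `X` at the unit is a multiple of the central vector, to which it is orthogonal, so
    -- its norm is zero.
    by_contra! h
    have hc : R.X 0 = R.X 0 (Sum.inr ()) • Heisenberg.center := by
      funext k
      rcases k with k | u
      · simp [h, Heisenberg.center_inl]
      · simp [Heisenberg.center_inr]
    have hXZ := Heisenberg.formCLM_X_center R hn hinv hDouglas
    have hpos := (Heisenberg.toTwoStep R hn hinv hDouglas).B_pos (R.X 0) h0
    have hXX : Heisenberg.formCLM (R.g 0) (R.X 0) (R.X 0) = 0 := by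
      nth_rewrite 2 [hc]
      rw [map_smul, hXZ, smul_zero]
    exact hpos.ne' hXX
  · simp only [Heisenberg.Idx, Fintype.card_sum, Fintype.card_fin, Fintype.card_unit]
    omega
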